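/- For $a,b\in\mathbb N$ let $S_{a,b}$ be the double star with central edge $uv$, with $a$ leaves joined to $u$ and $b$ leaves joined to $v$. All graphs are finite and simple. A graph is $S_{a,b}$-free if it does not contain $S_{a,b}$ as a (not necessarily induced) subgraph, and $\mathrm{ex}(n,S_{a,b})$ is the maximum number of edges of an $S_{a,b}$-free graph on $n$ vertices. Let $n,b\in\mathbb N$ with $b>3$ and $n\ge b+5$, and let $G$ be a connected $S_{3,b}$-free graph on $n$ vertices with $e(G)=\mathrm{ex}(n,S_{3,b})$. Then $n<2(b+4)$, and, writing $\Delta(G)$ for the maximum degree of $G$: (i) if $b\le 10$, or if $b\ge 11$ and $n\notin\{2b+1,2b+2\}$, then $\Delta(G)=b$ and $e(G)=\left\lfloor\frac{bn}{2}\right\rfloor$; (ii) if $b\ge 11$ and $n=2b+1$, then $\Delta(G)=b+1$ and $e(G)=\left\lfloor\frac{bn+3}{2}\right\rfloor$; (iii) if $b\ge 11$ and $n=2b+2$, then $\Delta(G)=b+1$ and $e(G)=\left\lfloor\frac{bn+2+\lfloor b/2\rfloor}{2}\right\rfloor$. -/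

import Mathlib

/-- The double star `S_{a,b}`: two adjacent centres, `u = Sum.inl none` and `v = Sum.inr none`,
with `a` leaves `Sum.inl (some i)` attached to `u` and `b` leaves `Sum.inr (some j)` attached
to `v`. (`SimpleGraph.fromRel` symmetrizes the listed relation.) -/
def doubleStar (a b : ℕ) : SimpleGraph (Option (Fin a) ⊕ Option (Fin b)) :=
  SimpleGraph.fromRel fun x y =>
    match x, y with
    | Sum.inl none, Sum.inr none => True
    | Sum.inl none, Sum.inl (some _) => True
    | Sum.inr none, Sum.inr (some _) => True
    | _, _ => False

/-- `G ∈ Ex(n, F)`: `G` has `n` vertices, does not contain `F` as a (not necessarily induced)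
subgraph, and has `ex(n, F)` edges. -/
def MemEx {V W : Type*} [Fintype V] (n : ℕ) (F : SimpleGraph W) (G : SimpleGraph V)
    [DecidableRel G.Adj] : Prop :=
  Fintype.card V = n ∧ F.Free G ∧ G.edgeFinset.card = SimpleGraph.extremalNumber n F

/-!
A double star with three leaves at `u` and `b` leaves at `v` exists exactly when `uv` is an edge
with `deg u ≥ 4`, `deg v ≥ b + 1` and `|N(u) ∪ N(v)| ≥ b + 5` (`doubleStar_isContained_iff`). Hence
a vertex `v` of degree at least `b + 1` nearly confines its neighbours, apart from those of degree
at most `3`, to the closed neighbourhood `N[v]`: the larger the degree of `v`, the fewer neighbours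
they may have outside.

Extremality enters through one comparison: a set `T` of at most `b + 4` vertices may be cut off and
turned into a clique, so `T` meets at least as many edges as a clique on `T` has
(`IsExtremal.le_incidenceSum`). Applied to `N[v]`, enlarged by one or two vertices if it is smaller
than `b + 4`, this shows that a connected extremal graph has maximum degree at most `b + 1`
(`IsExtremal.degree_le_add_one`), and that, for `deg v = b + 1`, the vertices of degree `b + 1` in
`N[v]` have no neighbours outside `N[v]` (`IsExtremal.sdiff_closedNeighborFinset_eq_empty`).

If `h` vertices of `N[v]` have degree `b + 1`, the other `b + 2 - h` have at most two neighbours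
outside each. Counting the edges that meet `N[v]`, and at most a clique on the remaining
`r = n - b - 2` vertices, gives `2 e(G) - b n ≤ 2 b + 4 - h - r (b + 1 - r)`. On the other hand
`2 e(G) - b n` is at most the number of vertices of degree `b + 1`. If these all lie in `N[v]`, the
latter bound is `h`, and the two bounds balance to the values claimed for `n = 2 b + 1` and
`n = 2 b + 2`; otherwise two closed neighbourhoods overlap, which does not allow more edges
(`IsExtremal.exists_card_inter`). In all other cases the bounds are beaten by nearly `b`-regular
graphs or by disjoint cliques; for `n ≥ 2 b + 4` the cliques have average degree above `b + 1`
(`mul_lt_two_mul_extremalNumber`), so that no connected extremal graph exists.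

The lower bounds need nearly regular graphs, obtained by exchanging edges
(`exists_degree_le_and_sum_le`), and for the two exceptional values of `n` the graphs `cliquesJoin`.
-/

open Finset

namespace SimpleGraph

/-! ### Double stars and degrees -/

section Free

variable {V : Type*} [Fintype V] [DecidableEq V] {G : SimpleGraph V} [DecidableRel G.Adj] {a b : ℕ}

/-- Given the three inequalities, disjoint sets of leaves are found greedily: those at `u` are taken
outside `N(v)` as far as possible. -/
theorem doubleStar_isContained_iff :
    doubleStar a b ⊑ G ↔ ∃ u v, G.Adj u v ∧ a + 1 ≤ G.degree u ∧ b + 1 ≤ G.degree v ∧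
      a + b + 2 ≤ #(G.neighborFinset u ∪ G.neighborFinset v) := by
  constructor
  · rintro ⟨f⟩
    have hadj : ∀ {x y}, (doubleStar a b).Adj x y → G.Adj (f x) (f y) := fun h => f.toHom.map_adj h
    have huv : (doubleStar a b).Adj (Sum.inl none) (Sum.inr none) := by simp [doubleStar]
    have hu (i) : (doubleStar a b).Adj (Sum.inl none) (Sum.inl (some i)) := by simp [doubleStar]
    have hv (i) : (doubleStar a b).Adj (Sum.inr none) (Sum.inr (some i)) := by simp [doubleStar]
    have hinj : Function.Injective f := f.injective
    refine ⟨f (Sum.inl none), f (Sum.inr none), hadj huv, ?_, ?_, ?_⟩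
    · rw [← card_neighborFinset_eq_degree]
      have : (univ : Finset (Option (Fin a))).image
          (fun i => f (i.elim (Sum.inr none) fun i => Sum.inl (some i))) ⊆
          G.neighborFinset (f (Sum.inl none)) := by
        intro y hy
        obtain ⟨i, -, rfl⟩ := mem_image.1 hy
        rw [mem_neighborFinset]
        cases i with
        | none => exact hadj huv
        | some i => exact hadj (hu i)
      have h2 := card_le_card this
      rw [card_image_of_injective, card_univ, Fintype.card_option, Fintype.card_fin] at h2
      · exact h2
      · intro i j hij
        have := hinj hij
        cases i <;> cases j <;> simp_all
    · rw [← card_neighborFinset_eq_degree]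
      have : (univ : Finset (Option (Fin b))).image
          (fun i => f (i.elim (Sum.inl none) fun i => Sum.inr (some i))) ⊆
          G.neighborFinset (f (Sum.inr none)) := by
        intro y hy
        obtain ⟨i, -, rfl⟩ := mem_image.1 hy
        rw [mem_neighborFinset]
        cases i with
        | none => exact (hadj huv).symm
        | some i => exact hadj (hv i)
      have h2 := card_le_card this
      rw [card_image_of_injective, card_univ, Fintype.card_option, Fintype.card_fin] at h2
      · exact h2
      · intro i j hij
        have := hinj hij
        cases i <;> cases j <;> simp_all
    · have : univ.image f ⊆
          G.neighborFinset (f (Sum.inl none)) ∪ G.neighborFinset (f (Sum.inr none)) := by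
        intro y hy
        obtain ⟨i, -, rfl⟩ := mem_image.1 hy
        rw [mem_union, mem_neighborFinset, mem_neighborFinset]
        rcases i with (_ | i) | (_ | i)
        · exact Or.inr (hadj huv).symm
        · exact Or.inl (hadj (hu i))
        · exact Or.inl (hadj huv)
        · exact Or.inr (hadj (hv i))
      have h2 := card_le_card this
      rw [card_image_of_injective _ hinj, card_univ, Fintype.card_sum, Fintype.card_option,
        Fintype.card_option, Fintype.card_fin, Fintype.card_fin] at h2
      omega
  · rintro ⟨u, v, huv, hu, hv, hc⟩
    obtain ⟨A, hA, hAc, hB⟩ : ∃ A ⊆ (G.neighborFinset u).erase v, #A = a ∧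
        b ≤ #((G.neighborFinset v).erase u \ A) := by
      have hvu : v ∈ G.neighborFinset u := by simpa using huv
      have huv' : u ∈ G.neighborFinset v := by simpa using huv.symm
      have h1 : #((G.neighborFinset u).erase v) = G.degree u - 1 := by
        rw [card_erase_of_mem hvu, card_neighborFinset_eq_degree]
      have h2 : #((G.neighborFinset v).erase u) = G.degree v - 1 := by
        rw [card_erase_of_mem huv', card_neighborFinset_eq_degree]
      rcases le_total a #((G.neighborFinset u).erase v \ G.neighborFinset v) with h | h
      · obtain ⟨A, hA, hAc⟩ := exists_subset_card_eq h
        refine ⟨A, hA.trans sdiff_subset, hAc, ?_⟩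
        rw [sdiff_eq_self_of_disjoint]
        · omega
        · rw [Finset.disjoint_left]
          intro y hy hy'
          exact (mem_sdiff.1 (hA hy')).2 (mem_of_mem_erase hy)
      · obtain ⟨A, hA, hA', hAc⟩ := exists_subsuperset_card_eq sdiff_subset h
          (show a ≤ #((G.neighborFinset u).erase v) by omega)
        refine ⟨A, hA', hAc, ?_⟩
        have h3 : G.neighborFinset u ∪ G.neighborFinset v ⊆
            ((G.neighborFinset v).erase u \ A) ∪ (A ∪ {u, v}) := by
          intro y hy
          by_cases hyu : y = u
          · simp [hyu]
          by_cases hyv : y = v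
          · simp [hyv]
          by_cases hyA : y ∈ A
          · simp [hyA]
          have : y ∈ G.neighborFinset v := by
            by_contra hyn
            rcases mem_union.1 hy with h | h
            · exact hyA (hA (by simp_all))
            · exact hyn h
          simp_all
        have h4 := card_le_card h3
        have h5 := card_union_le ((G.neighborFinset v).erase u \ A) (A ∪ {u, v})
        have h6 := card_union_le A {u, v}
        have h7 := card_le_two (a := u) (b := v)
        omega
    obtain ⟨B, hB', hBc⟩ := exists_subset_card_eq hB
    let eA := (A.equivFinOfCardEq hAc).symm
    let eB := (B.equivFinOfCardEq hBc).symm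
    have hA1 (i) : (eA i : V) ≠ v ∧ G.Adj u (eA i) := by simpa using hA (eA i).2
    have hB1 (i) : ((eB i : V) ≠ u ∧ G.Adj v (eB i)) ∧ (eB i : V) ∉ A := by
      simpa using hB' (eB i).2
    let f : Option (Fin a) ⊕ Option (Fin b) → V :=
      Sum.elim (fun i => i.elim u fun i => eA i) (fun i => i.elim v fun i => eB i)
    refine ⟨⟨⟨f, ?_⟩, ?_⟩⟩
    · rintro ((_ | i) | (_ | i)) ((_ | j) | (_ | j)) h <;>
        simp [doubleStar, f] at h ⊢
      · exact (hA1 _).2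
      · exact huv
      · exact (hA1 _).2.symm
      · exact huv.symm
      · exact (hB1 _).1.2
      · exact (hB1 _).1.2.symm
    · change Function.Injective f
      have hne := huv.ne
      have hA2 (i) : u ≠ (eA i : V) := (hA1 i).2.ne
      have hB2 (i) : v ≠ (eB i : V) := (hB1 i).1.2.ne
      have hAB (i j) : (eA i : V) ≠ eB j := fun h => (hB1 j).2 (h ▸ (eA i).2)
      rintro ((_ | i) | (_ | i)) ((_ | j) | (_ | j)) h <;>
        simp [f] at h ⊢
      · exact hA2 _ h
      · exact hne h
      · exact (hB1 _).1.1 h.symm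
      · exact hA2 _ h.symm
      · exact h
      · exact (hA1 _).1 h
      · exact hAB _ _ h
      · exact hne h.symm
      · exact (hA1 _).1 h.symm
      · exact hB2 _ h
      · exact (hB1 _).1.1 h
      · exact hAB _ _ h.symm
      · exact hB2 _ h.symm
      · exact h

theorem free_doubleStar_iff :
    (doubleStar a b).Free G ↔ ∀ u v, G.Adj u v → a + 1 ≤ G.degree u → b + 1 ≤ G.degree v →
      #(G.neighborFinset u ∪ G.neighborFinset v) ≤ a + b + 1 := by
  rw [Free, doubleStar_isContained_iff]
  push Not
  simp only [Nat.lt_succ_iff]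

/-- A graph of maximum degree at most `b` has no room for the centre of degree `b + 1`. -/
theorem free_doubleStar_of_degree_le (h : ∀ v, G.degree v ≤ b) : (doubleStar a b).Free G := by
  rw [free_doubleStar_iff]
  intro u v _ _ hv
  have := h v
  omega

end Free

/-! ### Graphs with prescribed degrees -/

theorem degree_eq_sum_edgeFinset {V : Type*} [DecidableEq V] (G : SimpleGraph V) (v : V)
    [Fintype (G.neighborSet v)] [Fintype G.edgeSet] :
    G.degree v = ∑ e ∈ G.edgeFinset, if v ∈ e then 1 else 0 := by
  rw [← card_incidenceFinset_eq_degree, incidenceFinset_eq_filter, card_filter]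

section Degrees

variable {V : Type*} [Fintype V] [DecidableEq V]

/-- Replacing the edge `zw` by `xz` and `yw` raises the degrees of `x` and `y` by one each
(by two if `x = y`) and leaves all others unchanged. -/
theorem exists_degree_eq_add_of_exchange (G : SimpleGraph V) [DecidableRel G.Adj] {x y z w : V}
    (hzw : G.Adj z w) (hxz : ¬G.Adj x z) (hxz' : x ≠ z) (hyw : ¬G.Adj y w) (hyw' : y ≠ w) :
    ∃ (G' : SimpleGraph V) (_ : DecidableRel G'.Adj),
      ∀ v, G'.degree v = G.degree v + (if v = x then 1 else 0) + (if v = y then 1 else 0) := by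
  classical
  let E : Finset (Sym2 V) := insert s(x, z) (insert s(y, w) (G.edgeFinset.erase s(z, w)))
  refine ⟨fromEdgeSet (E : Set (Sym2 V)), inferInstance, fun v => ?_⟩
  have hE : (fromEdgeSet (E : Set (Sym2 V))).edgeFinset = E := by
    ext e
    rw [mem_edgeFinset, edgeSet_fromEdgeSet, Set.mem_sdiff, mem_coe]
    refine and_iff_left_of_imp fun he => ?_
    simp only [E, mem_insert, mem_erase, mem_edgeFinset] at he
    rcases he with rfl | rfl | ⟨-, he⟩
    · simpa using hxz'
    · simpa using hyw'
    · exact G.not_isDiag_of_mem_edgeSet he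
  have h1 : s(y, w) ∉ G.edgeFinset.erase s(z, w) := by simp [hyw]
  have h2 : s(x, z) ∉ insert s(y, w) (G.edgeFinset.erase s(z, w)) := by
    simp only [mem_insert, mem_erase, mem_edgeFinset, mem_edgeSet, hxz, and_false, or_false,
      Sym2.eq_iff]
    rintro (⟨rfl, rfl⟩ | ⟨rfl, rfl⟩)
    · exact hzw.ne rfl
    · exact hxz hzw.symm
  rw [degree_eq_sum_edgeFinset, degree_eq_sum_edgeFinset, hE, sum_insert h2, sum_insert h1,
    ← add_sum_erase G.edgeFinset _ (show s(z, w) ∈ G.edgeFinset by simpa using hzw)]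
  have hz := hzw.ne
  simp only [Sym2.mem_iff]
  by_cases h3 : v = x <;> by_cases h4 : v = y <;> by_cases h5 : v = z <;> by_cases h6 : v = w <;>
    simp_all <;> omega

theorem exists_degree_eq_add_of_not_adj (G : SimpleGraph V) [DecidableRel G.Adj] {x y : V}
    (hxy : ¬G.Adj x y) (hne : x ≠ y) :
    ∃ (G' : SimpleGraph V) (_ : DecidableRel G'.Adj),
      ∀ v, G'.degree v = G.degree v + (if v = x then 1 else 0) + (if v = y then 1 else 0) := by
  classical
  refine ⟨G ⊔ edge x y, inferInstance, fun v => ?_⟩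
  rw [degree_eq_sum_edgeFinset, degree_eq_sum_edgeFinset, edgeFinset_sup_edge _ hxy hne, sum_cons]
  simp only [Sym2.mem_iff]
  by_cases h3 : v = x <;> by_cases h4 : v = y <;> simp_all <;> omega

/-- Degrees bounded by a function `f` that is constant except perhaps for one larger value are
attained up to parity: a graph with as many edges as possible misses at most one incidence, since
otherwise some exchange of edges would produce one edge more. -/
theorem exists_degree_le_and_sum_le (f : V → ℕ) (d : ℕ) (w₀ : V) (hd : ∀ v, v ≠ w₀ → f v = d)
    (h0 : f w₀ = d ∨ f w₀ = d + 1) (hlt : ∀ v, f v < Fintype.card V) :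
    ∃ (G : SimpleGraph V) (_ : DecidableRel G.Adj),
      (∀ v, G.degree v ≤ f v) ∧ ∑ v, f v ≤ ∑ v, G.degree v + 1 := by
  classical
  obtain ⟨G, hdec, hG, hmax⟩ := (exists_isExtremal_iff_exists
    (fun G : SimpleGraph V => ∀ v, G.degree v ≤ f v)).2 ⟨⊥, fun v => by simp⟩
  have hG' : ∀ v, G.degree v ≤ f v := fun v => by convert! hG v
  refine ⟨G, hdec, hG', ?_⟩
  by_contra! hcon
  -- No graph within the bounds has exactly the degrees of `G` raised at `x` and at `y`.
  have key : ∀ x y, (x ≠ y ∧ G.degree x < f x ∧ G.degree y < f y ∨ x = y ∧ G.degree x + 2 ≤ f x) →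
      ¬ ∃ (G' : SimpleGraph V) (_ : DecidableRel G'.Adj), ∀ v, G'.degree v =
        G.degree v + (if v = x then 1 else 0) + (if v = y then 1 else 0) := by
    rintro x y hxy ⟨G', hdec', hG''⟩
    have h1 : #G'.edgeFinset ≤ #G.edgeFinset := by
      refine hmax fun v => ?_
      have h2 := hG'' v
      have h3 := hG' v
      have h4 : G'.degree v ≤ f v := by
        rw [h2]
        rcases hxy with ⟨hne, hx, hy⟩ | ⟨rfl, hx⟩
        · split_ifs with hvx hvy hvy
          · exact absurd (hvx.symm.trans hvy) hne
          · subst hvx; omega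
          · subst hvy; omega
          · omega
        · split_ifs with hvx
          · subst hvx; omega
          · omega
      convert! h4
    have h2 := G'.sum_degrees_eq_twice_card_edges
    have h3 := G.sum_degrees_eq_twice_card_edges
    simp only [hG'', sum_add_distrib, sum_ite_eq', mem_univ, if_true] at h2
    omega
  have hfd : ∀ v, d ≤ f v := fun v => by
    by_cases h : v = w₀
    · subst h; omega
    · exact (hd v h).ge
  -- The exchange: a non-neighbour `z` of `x` has a neighbour `w` that is not a neighbour of `y`.
  have main : ∀ x y, (x ≠ y ∧ G.degree x < f x ∧ G.degree y < f y ∨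
      x = y ∧ G.degree x + 2 ≤ f x) → (x = y ∨ y ≠ w₀) → False := by
    intro x y hxy hy
    have hk := key x y hxy
    obtain ⟨z, hz⟩ : ∃ z, z ∉ insert x (G.neighborFinset x) := by
      by_contra! h
      have h2 : Fintype.card V ≤ #(insert x (G.neighborFinset x)) := by
        rw [← card_univ]; exact card_le_card fun v _ => h v
      have h3 := card_insert_le x (G.neighborFinset x)
      have h4 := hlt x
      rw [card_neighborFinset_eq_degree] at h3
      have : G.degree x < f x := by omega
      omega
    simp only [mem_insert, mem_neighborFinset, not_or] at hz
    have hxyadj : x ≠ y → G.Adj x y := fun hne => by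
      by_contra h
      exact hk (exists_degree_eq_add_of_not_adj G h hne)
    have hzy : z ≠ y := fun h => by
      subst h
      exact hz.2 (hxyadj (Ne.symm hz.1))
    have hzfull : G.degree z = f z := by
      by_contra h
      have : G.degree z < f z := lt_of_le_of_ne (hG' z) h
      exact key x z (Or.inl ⟨Ne.symm hz.1, by omega, this⟩)
        (exists_degree_eq_add_of_not_adj G hz.2 (Ne.symm hz.1))
    obtain ⟨w, hw, hw'⟩ : ∃ w ∈ G.neighborFinset z, w ∉ insert y (G.neighborFinset y) := by
      by_contra! h
      have hz1 := hfd z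
      have hx1 : x ∉ G.neighborFinset z := by simpa [adj_comm] using hz.2
      by_cases hxe : x = y
      · subst hxe
        have h2 : G.neighborFinset z ⊆ G.neighborFinset x := fun v hv => by
          have h3 := h v hv
          rcases mem_insert.1 h3 with rfl | h3
          · exact absurd hv hx1
          · exact h3
        have h3 := card_le_card h2
        rw [card_neighborFinset_eq_degree, card_neighborFinset_eq_degree] at h3
        have : f x ≤ d + 1 := by
          by_cases h : x = w₀
          · subst h; omega
          · have := hd x h; omega
        have : G.degree x + 2 ≤ f x := hxy.elim (fun h => absurd rfl h.1) fun h => h.2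
        omega
      · have h2 : (G.neighborFinset z).erase y ⊆ (G.neighborFinset y).erase x := fun v hv => by
          obtain ⟨hv1, hv2⟩ := mem_erase.1 hv
          refine mem_erase.2 ⟨fun h => hx1 (h ▸ hv2), ?_⟩
          exact (mem_insert.1 (h v hv2)).resolve_left hv1
        have h3 := card_le_card h2
        have hyx : x ∈ G.neighborFinset y := by simpa using (hxyadj hxe).symm
        rw [card_erase_of_mem hyx, card_neighborFinset_eq_degree] at h3
        have h4 := pred_card_le_card_erase (s := G.neighborFinset z) (a := y)
        have h5 := hd y (hy.resolve_left hxe)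
        have h6 := card_pos.2 ⟨x, hyx⟩
        rw [card_neighborFinset_eq_degree] at h6
        have h7 : G.degree y < f y := hxy.elim (fun h => h.2.2) fun h => absurd h.1 hxe
        rw [card_neighborFinset_eq_degree] at h4
        omega
    simp only [mem_insert, mem_neighborFinset, not_or] at hw hw'
    exact hk (exists_degree_eq_add_of_exchange G hw hz.2 (Ne.symm hz.1) hw'.2 (Ne.symm hw'.1))
  -- Locate two missing incidences.
  have hsum : ∑ v, (f v - G.degree v) + ∑ v, G.degree v = ∑ v, f v := by
    rw [← sum_add_distrib]
    exact sum_congr rfl fun v _ => Nat.sub_add_cancel (hG' v)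
  by_cases h2 : ∃ x, G.degree x + 2 ≤ f x
  · obtain ⟨x, hx⟩ := h2
    exact main x x (Or.inr ⟨rfl, hx⟩) (Or.inl rfl)
  · push Not at h2
    have h3 : ∑ v, (f v - G.degree v) = #{v | G.degree v < f v} := by
      rw [card_filter]
      refine sum_congr rfl fun v _ => ?_
      have := h2 v
      have := hG' v
      split_ifs <;> omega
    have h4 : 1 < #{v | G.degree v < f v} := by omega
    obtain ⟨x, hx, y, hy, hne⟩ := one_lt_card.1 h4
    simp only [mem_filter, mem_univ, true_and] at hx hy
    by_cases hyw : y = w₀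
    · exact main y x (Or.inl ⟨hne.symm, hy, hx⟩) (Or.inr fun h => hne (h.trans hyw.symm))
    · exact main x y (Or.inl ⟨hne, hx, hy⟩) (Or.inr hyw)

end Degrees

/-! ### Lower bounds for the extremal number -/

section LowerBounds

theorem sum_degree_le_two_mul_extremalNumber {V W : Type*} [Fintype V] {F : SimpleGraph W}
    {G : SimpleGraph V} [DecidableRel G.Adj] (h : F.Free G) :
    ∑ v, G.degree v ≤ 2 * extremalNumber (Fintype.card V) F := by
  rw [sum_degrees_eq_twice_card_edges]
  exact Nat.mul_le_mul_left 2 (card_edgeFinset_le_extremalNumber h)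

/-- A clique on at most `a + b + 1` vertices can be added as a separate component without
creating a double star. -/
theorem two_mul_extremalNumber_add_le (a b m t : ℕ) (ht : t ≤ a + b + 1) :
    2 * extremalNumber m (doubleStar a b) + t * (t - 1) ≤
      2 * extremalNumber (m + t) (doubleStar a b) := by
  classical
  obtain ⟨G, hdec, hG⟩ := exists_isExtremal_free (V := Fin m) (H := doubleStar a b) (by
    intro h
    have : (doubleStar a b).Adj (Sum.inl none) (Sum.inr none) := by simp [doubleStar]
    rw [h] at this
    exact this)
  have hfree := hG.1
  have hcard := card_edgeFinset_of_isExtremal_free hG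
  rw [Fintype.card_fin] at hcard
  obtain ⟨G', hG'⟩ : ∃ G', G' = G ⊕g (⊤ : SimpleGraph (Fin t)) := ⟨_, rfl⟩
  have hl (v) : G'.neighborFinset (Sum.inl v) =
      (G.neighborFinset v).map Function.Embedding.inl := by
    ext (x | x) <;> rw [mem_neighborFinset, hG'] <;> simp
  have hr (v) : G'.neighborFinset (Sum.inr v) =
      ((⊤ : SimpleGraph (Fin t)).neighborFinset v).map Function.Embedding.inr := by
    ext (x | x) <;> rw [mem_neighborFinset, hG'] <;> simp [eq_comm]
  have hdl (v) : G'.degree (Sum.inl v) = G.degree v := by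
    rw [← card_neighborFinset_eq_degree, hl, card_map, card_neighborFinset_eq_degree]
  have hdr (v) : G'.degree (Sum.inr v) = t - 1 := by
    rw [← card_neighborFinset_eq_degree, hr, card_map, card_neighborFinset_eq_degree,
      complete_graph_degree, Fintype.card_fin]
  have h1 : (doubleStar a b).Free G' := by
    rw [free_doubleStar_iff] at hfree ⊢
    rintro (u | u) (v | v) huv hu hv
    · rw [hl, hl, ← map_union, card_map]
      rw [hdl] at hu hv
      exact hfree u v (by simpa [hG'] using huv) hu hv
    · simp [hG'] at huv
    · simp [hG'] at huv
    · rw [hr, hr, ← map_union, card_map]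
      refine (card_le_univ _).trans ?_
      rwa [Fintype.card_fin]
  have h2 := sum_degree_le_two_mul_extremalNumber h1
  rw [Fintype.sum_sum_type] at h2
  simp only [hdl, hdr, sum_degrees_eq_twice_card_edges, hcard, Fintype.card_sum, Fintype.card_fin,
    sum_const, card_univ, smul_eq_mul] at h2
  exact h2

theorem mul_pred_le_two_mul_extremalNumber (a b t : ℕ) (ht : t ≤ a + b + 1) :
    t * (t - 1) ≤ 2 * extremalNumber t (doubleStar a b) := by
  have := two_mul_extremalNumber_add_le a b 0 t ht
  rw [zero_add] at this
  omega

theorem mul_le_two_mul_extremalNumber_add_one (a b n : ℕ) (hn : b < n) :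
    b * n ≤ 2 * extremalNumber n (doubleStar a b) + 1 := by
  obtain ⟨G, hdec, h1, h2⟩ := exists_degree_le_and_sum_le (V := Fin n) (fun _ => b) b
    ⟨0, by omega⟩ (fun _ _ => rfl) (Or.inl rfl) (fun _ => by simpa using hn)
  have h3 := sum_degree_le_two_mul_extremalNumber (free_doubleStar_of_degree_le (a := a) h1)
  rw [Fintype.card_fin] at h3
  simp only [sum_const, card_univ, Fintype.card_fin, smul_eq_mul] at h2
  rw [mul_comm]
  omega

/-- From `2 * b + 4` vertices on, cliques on `b + 4` vertices give average degree above `b + 1`. -/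
theorem mul_lt_two_mul_extremalNumber (b n : ℕ) (hn : 2 * b + 4 ≤ n) :
    (b + 1) * n < 2 * extremalNumber n (doubleStar 3 b) := by
  induction n using Nat.strong_induction_on with
  | _ n ih =>
    obtain ⟨m, rfl⟩ : ∃ m, n = m + (b + 4) := ⟨n - (b + 4), by omega⟩
    have h1 := two_mul_extremalNumber_add_le 3 b m (b + 4) (by omega)
    rw [show b + 4 - 1 = b + 3 by omega] at h1
    rcases Nat.lt_or_ge m (2 * b + 4) with hm | hm
    · rcases Nat.lt_or_ge b m with hbm | hbm
      · have h2 := mul_le_two_mul_extremalNumber_add_one 3 b m hbm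
        nlinarith
      · obtain rfl : m = b := by omega
        have h2 := mul_pred_le_two_mul_extremalNumber 3 m m (by omega)
        rcases m with _ | m
        · omega
        · rw [show m + 1 - 1 = m by omega] at h2
          nlinarith
    · have h2 := ih m (by omega) hm
      nlinarith

end LowerBounds

/-! ### Connected constructions with vertices of degree `b + 1` -/

section Construction

variable {H W R : Type*}

/-- The graph on `H ⊕ W ⊕ R` in which `H` and `R` are cliques, `H` is completely joined to `W`,
`W` carries the graph `K`, and `W` is joined to `R` by the relation `P`. -/
def cliquesJoin (H : Type*) (K : SimpleGraph W) (P : W → R → Prop) :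
    SimpleGraph (H ⊕ W ⊕ R) where
  Adj x y :=
    match x, y with
    | Sum.inl x, Sum.inl y => x ≠ y
    | Sum.inl _, Sum.inr (Sum.inl _) => True
    | Sum.inr (Sum.inl _), Sum.inl _ => True
    | Sum.inr (Sum.inl x), Sum.inr (Sum.inl y) => K.Adj x y
    | Sum.inr (Sum.inl x), Sum.inr (Sum.inr y) => P x y
    | Sum.inr (Sum.inr x), Sum.inr (Sum.inl y) => P y x
    | Sum.inr (Sum.inr x), Sum.inr (Sum.inr y) => x ≠ y
    | _, _ => False
  symm := ⟨by
    rintro (x | x | x) (y | y | y) h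
    all_goals first | exact h | exact Ne.symm h | exact K.adj_symm h⟩
  loopless := ⟨by
    rintro (x | x | x) h
    · exact h rfl
    · exact K.loopless.irrefl x h
    · exact h rfl⟩

variable [Fintype H] [Fintype W] [Fintype R]

/-- The graph `cliquesJoin H K P` gives this bound when `H` and `W` have `b + 2` elements together,
all vertices of `R` have degree `b`, and `K` is chosen so that those of `W` have degree `b` up to
parity. The vertices of `H` have degree `b + 1` but are not centres of a double star, as each vertex
of `W` has at most two neighbours in `R`. -/
theorem mul_add_card_le_two_mul_extremalNumber {b : ℕ} (P : W → R → Prop)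
    [∀ w, DecidablePred (P w)] (w₀ : W)
    (hHW : Fintype.card H + Fintype.card W = b + 2) (hH : Fintype.card H + 2 ≤ b)
    (hR : ∀ i, #{w | P w i} + (Fintype.card R - 1) = b)
    (hP : ∀ w, w ≠ w₀ → #{i | P w i} = 2) (hP₀ : #{i | P w₀ i} = 1 ∨ #{i | P w₀ i} = 2) :
    b * (Fintype.card H + (Fintype.card W + Fintype.card R)) + Fintype.card H ≤
      2 * extremalNumber (Fintype.card H + (Fintype.card W + Fintype.card R))
        (doubleStar 3 b) + 1 := by
  classical
  have hP2 : ∀ w, #{i | P w i} ≤ 2 := fun w => by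
    by_cases h : w = w₀
    · subst h; omega
    · exact (hP w h).le
  obtain ⟨K, hdec, hK1, hK2⟩ := exists_degree_le_and_sum_le
    (fun w : W => b - Fintype.card H - #{i | P w i}) (b - Fintype.card H - 2) w₀
    (fun w hw => by rw [hP w hw]) (by omega) (fun w => by omega)
  let G := cliquesJoin H K P
  have hG1 (x : H) : G.degree (Sum.inl x) = b + 1 := by
    rw [← card_neighborFinset_eq_degree, neighborFinset_eq_filter, card_filter,
      Fintype.sum_sum_type, Fintype.sum_sum_type, ← card_filter, ← card_filter, ← card_filter]
    simp [G, cliquesJoin, filter_ne]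
    have := Fintype.card_pos_iff.2 ⟨x⟩
    omega
  have hG2 (w : W) : G.degree (Sum.inr (Sum.inl w)) =
      Fintype.card H + (K.degree w + #{i | P w i}) := by
    rw [← card_neighborFinset_eq_degree, neighborFinset_eq_filter, card_filter,
      Fintype.sum_sum_type, Fintype.sum_sum_type, ← card_filter, ← card_filter, ← card_filter]
    simp [G, cliquesJoin, ← card_neighborFinset_eq_degree, neighborFinset_eq_filter]
  have hG3 (i : R) : G.degree (Sum.inr (Sum.inr i)) = b := by
    rw [← hR i, ← card_neighborFinset_eq_degree, neighborFinset_eq_filter, card_filter,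
      Fintype.sum_sum_type, Fintype.sum_sum_type, ← card_filter, ← card_filter, ← card_filter]
    simp [G, cliquesJoin, filter_ne]
  have hfree : (doubleStar 3 b).Free G := by
    rw [free_doubleStar_iff]
    intro u v huv _ hv
    obtain ⟨x, rfl⟩ : ∃ x, v = Sum.inl x := by
      rcases v with x | w | i
      · exact ⟨x, rfl⟩
      · have h1 := hK1 w
        have h2 := hP2 w
        rw [hG2] at hv
        omega
      · rw [hG3] at hv
        omega
    let S : Finset (H ⊕ W ⊕ R) := (univ : Finset H).disjSum ((univ : Finset W).disjSum ∅)
    have hS : #S = b + 2 := by simp [S, card_disjSum, hHW]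
    obtain ⟨T, hT, hu⟩ : ∃ T : Finset (H ⊕ W ⊕ R), #T ≤ 2 ∧ G.neighborFinset u ⊆ S ∪ T := by
      rcases u with y | w | i
      · refine ⟨∅, by simp, ?_⟩
        rintro (z | z | z) hz <;> rw [mem_neighborFinset] at hz <;> simp [S, G, cliquesJoin] at hz ⊢
      · refine ⟨({i | P w i} : Finset R).map (Function.Embedding.inr.trans Function.Embedding.inr),
          by rw [card_map]; exact hP2 w, ?_⟩
        rintro (z | z | z) hz <;> rw [mem_neighborFinset] at hz <;> simp [S, G, cliquesJoin] at hz ⊢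
        exact hz
      · exact absurd huv (by simp [G, cliquesJoin])
    have hv' : G.neighborFinset (Sum.inl x) ⊆ S ∪ T := by
      rintro (z | z | z) hz <;> rw [mem_neighborFinset] at hz <;> simp [S, G, cliquesJoin] at hz ⊢
    have h1 := card_le_card (union_subset hu hv')
    have h2 := card_union_le S T
    omega
  have h1 := sum_degree_le_two_mul_extremalNumber hfree
  rw [Fintype.card_sum, Fintype.card_sum, Fintype.sum_sum_type, Fintype.sum_sum_type] at h1
  simp only [hG1, hG2, hG3, sum_const, card_univ, smul_eq_mul] at h1
  have h2 : Fintype.card W * b ≤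
      ∑ w, (Fintype.card H + (K.degree w + #{i | P w i})) + 1 := by
    have h3 : Fintype.card W * b =
        ∑ w : W, (b - Fintype.card H - #{i | P w i}) + ∑ w : W, (Fintype.card H + #{i | P w i}) := by
      rw [← sum_add_distrib, ← card_univ, ← smul_eq_mul, ← sum_const]
      exact sum_congr rfl fun w _ => by have := hP2 w; omega
    have h4 : ∑ w, (Fintype.card H + (K.degree w + #{i | P w i})) =
        ∑ w, K.degree w + ∑ w : W, (Fintype.card H + #{i | P w i}) := by
      rw [← sum_add_distrib]
      exact sum_congr rfl fun w _ => by ring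
    omega
  have h5 : b * (Fintype.card H + (Fintype.card W + Fintype.card R)) + Fintype.card H =
      Fintype.card H * (b + 1) + (Fintype.card W * b + Fintype.card R * b) := by ring
  omega

/-- `H` has three elements, and `W` and `R` are joined by a cycle of length `2 * (b - 1)`. -/
theorem mul_add_three_le_two_mul_extremalNumber (b : ℕ) (hb : 5 ≤ b) :
    b * (2 * b + 1) + 3 ≤ 2 * extremalNumber (2 * b + 1) (doubleStar 3 b) + 1 := by
  obtain ⟨k, rfl⟩ : ∃ k, b = k + 3 := ⟨b - 3, by omega⟩
  have hne : ∀ j : Fin (k + 2), j ≠ j + 1 := fun j h => by simp at h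
  have h := mul_add_card_le_two_mul_extremalNumber (H := Fin 3) (b := k + 3)
    (fun w i : Fin (k + 2) => i = w ∨ i = w + 1) 0 (by simp; omega) (by simp; omega)
    (fun i => by
      have h1 : ({w | i = w ∨ i = w + 1} : Finset (Fin (k + 2))) = {i, i - 1} := by
        ext w
        simp [eq_comm, eq_sub_iff_add_eq]
      rw [h1, card_pair, Fintype.card_fin]
      · omega
      · intro h
        exact hne (i - 1) (by rw [sub_add_cancel]; exact h.symm))
    (fun w _ => by
      have h1 : ({i | i = w ∨ i = w + 1} : Finset (Fin (k + 2))) = {w, w + 1} := by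
        ext i
        simp
      rw [h1, card_pair (hne w)])
    (Or.inr <| by
      have h1 : ({i | i = 0 ∨ i = 0 + 1} : Finset (Fin (k + 2))) = {0, 0 + 1} := by
        ext i
        simp
      rw [h1, card_pair (hne 0)])
  simp only [Fintype.card_fin] at h
  rwa [show 3 + (k + 2 + (k + 2)) = 2 * (k + 3) + 1 by ring] at h

/-- `R` has `b` elements, distributed to the vertices of `W` in pairs. -/
theorem mul_add_half_le_two_mul_extremalNumber (b : ℕ) (hb : 7 ≤ b) :
    b * (2 * b + 2) + (b / 2 + 2) ≤ 2 * extremalNumber (2 * b + 2) (doubleStar 3 b) + 1 := by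
  have hle : ∀ w : Fin ((b + 1) / 2), #{i : Fin b | (i : ℕ) / 2 = w} ≤ 2 := fun w => by
    refine (card_map Fin.valEmbedding).symm.trans_le ((card_le_card
      (t := ({2 * (w : ℕ), 2 * (w : ℕ) + 1} : Finset ℕ)) ?_).trans card_le_two)
    intro x hx
    simp only [mem_map, mem_filter, mem_univ, true_and, Fin.valEmbedding_apply] at hx
    obtain ⟨i, hi, rfl⟩ := hx
    simp only [mem_insert, mem_singleton]
    omega
  have h := mul_add_card_le_two_mul_extremalNumber (H := Fin (b / 2 + 2)) (b := b)
    (fun (w : Fin ((b + 1) / 2)) (i : Fin b) => (i : ℕ) / 2 = w) ⟨(b + 1) / 2 - 1, by omega⟩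
    (by simp; omega) (by simp; omega)
    (fun i => by
      have h1 : ({w | (i : ℕ) / 2 = w} : Finset (Fin ((b + 1) / 2))) =
          {⟨(i : ℕ) / 2, by omega⟩} := by
        ext w
        simp [Fin.ext_iff, eq_comm]
      rw [h1, card_singleton, Fintype.card_fin]
      omega)
    (fun w hw => by
      refine le_antisymm (hle w) ?_
      have hw' : (w : ℕ) ≠ (b + 1) / 2 - 1 := fun h => hw (Fin.ext h)
      have hlt := w.2
      refine (card_pair (show (⟨2 * w, by omega⟩ : Fin b) ≠ ⟨2 * w + 1, by omega⟩ by
        simp)).symm.trans_le (card_le_card fun i hi => ?_)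
      simp only [mem_insert, mem_singleton, Fin.ext_iff, mem_filter, mem_univ, true_and] at hi ⊢
      omega)
    (by
      have h1 := hle ⟨(b + 1) / 2 - 1, by omega⟩
      have h2 : 0 < #{i : Fin b | (i : ℕ) / 2 = (⟨(b + 1) / 2 - 1, by omega⟩ :
          Fin ((b + 1) / 2))} := by
        refine card_pos.2 ⟨⟨b - 1, by omega⟩, ?_⟩
        simp only [mem_filter, mem_univ, true_and]
        omega
      omega)
  simp only [Fintype.card_fin] at h
  rwa [show b / 2 + 2 + ((b + 1) / 2 + b) = 2 * b + 2 by omega] at h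

end Construction

/-! ### Edges meeting a set of vertices in an extremal graph -/

section Incidence

variable {V : Type*} [Fintype V] [DecidableEq V] (G : SimpleGraph V) [DecidableRel G.Adj]

/-- Twice the number of edges of `G` that meet `T`: an edge inside `T` is counted in the degrees of
both of its ends, an edge leaving `T` in the degree of one end and once more as an outgoing edge. -/
def incidenceSum (T : Finset V) : ℕ :=
  ∑ x ∈ T, (G.degree x + #(G.neighborFinset x \ T))

/-- The closed neighbourhood of a vertex. -/
def closedNeighborFinset (v : V) : Finset V :=
  insert v (G.neighborFinset v)

variable {G}

theorem mem_closedNeighborFinset {v w : V} :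
    w ∈ G.closedNeighborFinset v ↔ w = v ∨ G.Adj v w := by
  simp [closedNeighborFinset]

theorem card_closedNeighborFinset (v : V) : #(G.closedNeighborFinset v) = G.degree v + 1 := by
  rw [closedNeighborFinset, card_insert_of_notMem (by simp), card_neighborFinset_eq_degree]

theorem sum_card_neighborFinset_inter (A B : Finset V) :
    ∑ x ∈ A, #(G.neighborFinset x ∩ B) = ∑ x ∈ B, #(G.neighborFinset x ∩ A) := by
  have h (A B : Finset V) : ∑ x ∈ A, #(G.neighborFinset x ∩ B) =
      ∑ x ∈ A, ∑ y ∈ B, if G.Adj x y then 1 else 0 := by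
    refine sum_congr rfl fun x _ => ?_
    rw [← card_filter]
    congr 1
    ext y
    simp [and_comm]
  rw [h, h, sum_comm]
  simp only [G.adj_comm]

/-- The edges of `G` split into those meeting `T` and those of the graph induced on the
complement. -/
theorem sum_degree_eq_incidenceSum_add (T : Finset V) :
    ∑ x, G.degree x = G.incidenceSum T + ∑ x ∈ Tᶜ, #(G.neighborFinset x \ T) := by
  have h1 : ∑ x ∈ Tᶜ, G.degree x =
      ∑ x ∈ Tᶜ, #(G.neighborFinset x \ T) + ∑ x ∈ Tᶜ, #(G.neighborFinset x ∩ T) := by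
    rw [← sum_add_distrib]
    refine sum_congr rfl fun x _ => ?_
    rw [card_sdiff_add_card_inter, card_neighborFinset_eq_degree]
  have h2 : ∑ x ∈ T, #(G.neighborFinset x \ T) = ∑ x ∈ T, #(G.neighborFinset x ∩ Tᶜ) :=
    sum_congr rfl fun x _ => by rw [sdiff_eq_inter_compl]
  rw [incidenceSum, sum_add_distrib, h2, sum_card_neighborFinset_inter T Tᶜ,
    ← sum_add_sum_compl T, h1]
  ring

theorem incidenceSum_insert {T : Finset V} {x : V} (hx : x ∉ T) :
    G.incidenceSum (insert x T) = G.incidenceSum T + 2 * #(G.neighborFinset x \ T) := by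
  have h1 := sum_degree_eq_incidenceSum_add (G := G) T
  have h2 := sum_degree_eq_incidenceSum_add (G := G) (insert x T)
  have h3 : ∑ y ∈ Tᶜ, #(G.neighborFinset y \ T) = #(G.neighborFinset x \ T) +
      ∑ y ∈ (insert x T)ᶜ, #(G.neighborFinset y \ T) := by
    rw [compl_insert]
    exact (add_sum_erase _ (fun y => #(G.neighborFinset y \ T)) (mem_compl.2 hx)).symm
  have h4 : ∑ y ∈ (insert x T)ᶜ, #(G.neighborFinset y \ T) =
      ∑ y ∈ (insert x T)ᶜ, #(G.neighborFinset y \ insert x T) +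
        ∑ y ∈ (insert x T)ᶜ, #(G.neighborFinset y ∩ {x}) := by
    rw [← sum_add_distrib]
    refine sum_congr rfl fun y _ => ?_
    rw [← card_union_of_disjoint]
    · congr 1
      ext z
      by_cases hz : z = x <;> simp [hz, hx]
    · rw [Finset.disjoint_left]
      intro z hz hz'
      simp_all
  have h5 : ∑ y ∈ (insert x T)ᶜ, #(G.neighborFinset y ∩ {x}) = #(G.neighborFinset x \ T) := by
    rw [sum_card_neighborFinset_inter, sum_singleton]
    congr 1
    ext z
    simp only [mem_inter, mem_neighborFinset, mem_compl, mem_insert, not_or, mem_sdiff]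
    exact ⟨fun h => ⟨h.1, h.2.2⟩, fun h => ⟨h.1, h.1.ne', h.2⟩⟩
  omega

variable {a b : ℕ}

/-- In an extremal graph no set `T` of at most `a + b + 1` vertices meets fewer edges than a clique
on `T` has: otherwise a separate clique on `T` would be an improvement. -/
theorem IsExtremal.le_incidenceSum (hG : G.IsExtremal (doubleStar a b).Free) (T : Finset V)
    (hT : #T ≤ a + b + 1) : #T * (#T - 1) ≤ G.incidenceSum T := by
  have h1 := two_mul_extremalNumber_add_le a b (Fintype.card V - #T) #T hT
  rw [Nat.sub_add_cancel (card_le_univ T), ← card_edgeFinset_of_isExtremal_free hG,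
    ← sum_degrees_eq_twice_card_edges, sum_degree_eq_incidenceSum_add T] at h1
  have h2 : (doubleStar a b).Free (G.induce {x | x ∈ Tᶜ}) := fun h =>
    hG.1 (h.trans ⟨Copy.induce G _⟩)
  have h3 := sum_degree_le_two_mul_extremalNumber h2
  have h4 : Fintype.card {x | x ∈ Tᶜ} = Fintype.card V - #T := by
    rw [← card_compl]
    exact Fintype.card_of_subtype _ fun x => by simp
  have h5 : ∑ x ∈ Tᶜ, #(G.neighborFinset x \ T) =
      ∑ x : {x | x ∈ Tᶜ}, (G.induce {x | x ∈ Tᶜ}).degree x := by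
    rw [sum_subtype Tᶜ (p := fun x => x ∈ {x | x ∈ Tᶜ}) (fun x => by simp)]
    refine sum_congr rfl fun x _ => ?_
    rw [← card_neighborFinset_eq_degree, ← card_map (Function.Embedding.subtype _)]
    congr 1
    ext y
    simp [and_comm]
  rw [h4] at h3
  omega

end Incidence

/-! ### The maximum degree of a connected extremal graph -/

section MaxDegree

variable {V : Type*} [Fintype V] [DecidableEq V] {G : SimpleGraph V} [DecidableRel G.Adj] {b : ℕ}

/-- A neighbour of a vertex `v` of degree at least `b + 1` has few neighbours outside `N(v)`, unless
its degree is at most `3`. -/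
theorem card_sdiff_neighborFinset_add_degree_le (hfree : (doubleStar 3 b).Free G) {v w : V}
    (hvw : G.Adj v w) (hv : b + 1 ≤ G.degree v) (hw : 4 ≤ G.degree w) :
    #(G.neighborFinset w \ G.neighborFinset v) + G.degree v ≤ b + 4 := by
  have h := free_doubleStar_iff.1 hfree w v hvw.symm hw hv
  have h2 := card_sdiff_add_card (G.neighborFinset w) (G.neighborFinset v)
  rw [card_neighborFinset_eq_degree] at h2
  omega

theorem card_sdiff_closedNeighborFinset_lt {v w : V} (hvw : G.Adj v w) :
    #(G.neighborFinset w \ G.closedNeighborFinset v) + 1 ≤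
      #(G.neighborFinset w \ G.neighborFinset v) := by
  refine card_lt_card (Finset.ssubset_iff_subset_ne.2 ⟨?_, fun h => ?_⟩)
  · exact sdiff_subset_sdiff subset_rfl (subset_insert _ _)
  · have h1 : v ∈ G.neighborFinset w \ G.neighborFinset v := by simp [hvw.symm]
    rw [← h] at h1
    simp [closedNeighborFinset] at h1

/-- The version of `card_sdiff_neighborFinset_add_degree_le` for closed neighbourhoods. -/
theorem card_sdiff_closedNeighborFinset_add_degree_le (hfree : (doubleStar 3 b).Free G) {v w : V}
    (hvw : G.Adj v w) (hv : b + 1 ≤ G.degree v) (hw : 4 ≤ G.degree w) :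
    #(G.neighborFinset w \ G.closedNeighborFinset v) + G.degree v ≤ b + 3 := by
  have h1 := card_sdiff_neighborFinset_add_degree_le hfree hvw hv hw
  have h2 := card_sdiff_closedNeighborFinset_lt hvw
  omega

theorem card_sdiff_closedNeighborFinset_lt_degree {v w : V} (hvw : G.Adj v w) :
    #(G.neighborFinset w \ G.closedNeighborFinset v) + 1 ≤ G.degree w := by
  have h1 := card_sdiff_closedNeighborFinset_lt hvw
  have h2 := card_le_card (sdiff_subset (s := G.neighborFinset w) (t := G.neighborFinset v))
  rw [card_neighborFinset_eq_degree] at h2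
  omega

theorem card_sdiff_closedNeighborFinset_self (v : V) :
    #(G.neighborFinset v \ G.closedNeighborFinset v) = 0 := by
  rw [card_eq_zero, sdiff_eq_empty_iff_subset]
  exact subset_insert _ _

/-- If `x ∉ N[v]` is adjacent to a vertex `w ∈ N[v]` of degree at least `b + 1`, then almost all
neighbours of `x` lie in `N(w)`, and those outside `N[v]` are limited by the neighbours of `w`
outside `N[v]`. -/
theorem card_sdiff_closedNeighborFinset_le (hfree : (doubleStar 3 b).Free G) {v w x : V}
    (hw : w ∈ G.closedNeighborFinset v) (hx : x ∈ G.neighborFinset w \ G.closedNeighborFinset v)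
    (hwd : b + 1 ≤ G.degree w) {k : ℕ}
    (hk : #(G.neighborFinset w \ G.closedNeighborFinset v) ≤ k + 1) :
    #(G.neighborFinset x \ G.closedNeighborFinset v) ≤ k + 2 := by
  obtain ⟨hwx, hxv⟩ := mem_sdiff.1 hx
  rw [mem_neighborFinset] at hwx
  have h1 : G.neighborFinset x \ G.closedNeighborFinset v ⊆
      ((G.neighborFinset x \ G.neighborFinset w).erase w) ∪
        ((G.neighborFinset w \ G.closedNeighborFinset v).erase x) := by
    intro y hy
    obtain ⟨hy1, hy2⟩ := mem_sdiff.1 hy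
    rw [mem_neighborFinset] at hy1
    by_cases h : G.Adj w y
    · refine mem_union_right _ (mem_erase.2 ⟨hy1.ne', mem_sdiff.2 ⟨by simpa using h, hy2⟩⟩)
    · refine mem_union_left _ (mem_erase.2 ⟨fun h => hy2 (h ▸ hw), mem_sdiff.2 ⟨?_, ?_⟩⟩)
      · simpa using hy1
      · simpa using h
  have h2 := (card_le_card h1).trans (card_union_le _ _)
  have hwm : w ∈ G.neighborFinset x \ G.neighborFinset w := by simp [hwx.symm]
  rw [card_erase_of_mem hx, card_erase_of_mem hwm] at h2
  by_cases hx4 : 4 ≤ G.degree x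
  · have := card_sdiff_neighborFinset_add_degree_le hfree hwx hwd hx4
    omega
  · have h3 := card_le_card (sdiff_subset (s := G.neighborFinset x)
      (t := G.closedNeighborFinset v))
    have h4 : #(G.neighborFinset x \ G.closedNeighborFinset v) < #(G.neighborFinset x) := by
      refine card_lt_card (Finset.ssubset_iff_subset_ne.2 ⟨sdiff_subset, fun h => ?_⟩)
      have : w ∈ G.neighborFinset x := by simpa using hwx.symm
      rw [← h] at this
      exact (mem_sdiff.1 this).2 hw
    rw [card_neighborFinset_eq_degree] at h4
    omega

/-- All neighbours of a vertex of degree at least `b + 4` have degree at most `3`, so a set of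
`b + 4` of them meets too few edges. -/
theorem IsExtremal.degree_lt_add_four (hG : G.IsExtremal (doubleStar 3 b).Free) (hb : 3 < b)
    (v : V) : G.degree v < b + 4 := by
  by_contra! hv
  rw [← card_neighborFinset_eq_degree] at hv
  obtain ⟨T, hT, hTc⟩ := exists_subset_card_eq hv
  rw [card_neighborFinset_eq_degree] at hv
  have h1 := hG.le_incidenceSum T (by omega)
  have h2 : G.incidenceSum T ≤ #T • 6 := by
    refine sum_le_card_nsmul _ _ _ fun w hw => ?_
    have hvw : G.Adj v w := by simpa using hT hw
    have h3 : G.degree w ≤ 3 := by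
      by_contra! h
      have := card_sdiff_closedNeighborFinset_add_degree_le hG.1 hvw (by omega) h
      omega
    have h4 := card_le_card (sdiff_subset (s := G.neighborFinset w) (t := T))
    rw [card_neighborFinset_eq_degree] at h4
    omega
  rw [hTc, smul_eq_mul] at h2
  rw [hTc, show b + 4 - 1 = b + 3 by omega] at h1
  nlinarith

/-- If `v` has degree `b + 3`, only neighbours of degree at most `3` can have neighbours outside
`N[v]`; there are none, since `N[v]` meets as many edges as a clique of its size. -/
theorem IsExtremal.degree_ne_add_three (hG : G.IsExtremal (doubleStar 3 b).Free) (hb : 3 < b)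
    (hconn : G.Connected) (hn : b + 5 ≤ Fintype.card V) (v : V) : G.degree v ≠ b + 3 := by
  intro hv
  have hC := card_closedNeighborFinset (G := G) v
  rw [hv] at hC
  have h1 := hG.le_incidenceSum (G.closedNeighborFinset v) (by omega)
  rw [hC] at h1
  have hout : ∀ w ∈ G.closedNeighborFinset v, 4 ≤ G.degree w →
      #(G.neighborFinset w \ G.closedNeighborFinset v) = 0 := by
    intro w hw hwd
    rcases mem_closedNeighborFinset.1 hw with rfl | hvw
    · exact card_sdiff_closedNeighborFinset_self w
    · have := card_sdiff_closedNeighborFinset_add_degree_le hG.1 hvw (by omega) hwd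
      omega
  have hle : ∀ w ∈ G.closedNeighborFinset v,
      G.degree w + #(G.neighborFinset w \ G.closedNeighborFinset v) ≤ b + 3 := by
    intro w hw
    have hlt := hG.degree_lt_add_four hb w
    by_cases hwd : 4 ≤ G.degree w
    · rw [hout w hw hwd]; omega
    · rcases mem_closedNeighborFinset.1 hw with rfl | hvw
      · omega
      · have := card_sdiff_closedNeighborFinset_lt_degree hvw
        omega
  have hsmall : ∀ w ∈ G.closedNeighborFinset v, 4 ≤ G.degree w := by
    by_contra! h
    obtain ⟨w, hw, hwd⟩ := h
    have h2 : G.incidenceSum (G.closedNeighborFinset v) <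
        ∑ w ∈ G.closedNeighborFinset v, (b + 3) := by
      refine sum_lt_sum hle ⟨w, hw, ?_⟩
      rcases mem_closedNeighborFinset.1 hw with rfl | hvw
      · omega
      · have := card_sdiff_closedNeighborFinset_lt_degree hvw
        omega
    rw [sum_const, hC, smul_eq_mul] at h2
    rw [show b + 3 + 1 - 1 = b + 3 by omega] at h1
    omega
  obtain ⟨x, hx⟩ : ∃ x, x ∉ G.closedNeighborFinset v := by
    by_contra! h
    have := card_le_card (fun y _ => h y : univ ⊆ G.closedNeighborFinset v)
    rw [card_univ] at this
    omega
  obtain ⟨p⟩ := hconn.preconnected v x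
  obtain ⟨d, -, hd1, hd2⟩ := p.exists_boundary_dart (G.closedNeighborFinset v : Set V)
    (by simp [closedNeighborFinset]) (by simpa using hx)
  have h3 := hout d.fst (by simpa using hd1) (hsmall _ (by simpa using hd1))
  rw [card_eq_zero, sdiff_eq_empty_iff_subset] at h3
  exact hd2 (by simpa using h3 (by simp))

/-- If `v` has degree `b + 2`, each vertex of `N[v]` of degree at least `4` has at most one
neighbour outside `N[v]`. As `N[v]` can be enlarged by any further vertex `x`, that vertex has many
neighbours outside `N[v]`. This keeps vertices with outside neighbours from having degree above `b`,
so `N[v]` meets no more edges than a clique, and `x` would need `b + 3` neighbours outside `N[v]`. -/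
theorem IsExtremal.degree_ne_add_two (hG : G.IsExtremal (doubleStar 3 b).Free) (hb : 3 < b)
    (hΔ : ∀ w, G.degree w ≤ b + 2) (hn : b + 5 ≤ Fintype.card V) (v : V) :
    G.degree v ≠ b + 2 := by
  intro hv
  have hC := card_closedNeighborFinset (G := G) v
  rw [hv] at hC
  have hx : ∀ x ∉ G.closedNeighborFinset v, (b + 4) * (b + 3) ≤
      G.incidenceSum (G.closedNeighborFinset v) +
        2 * #(G.neighborFinset x \ G.closedNeighborFinset v) := by
    intro x hx
    have h1 := hG.le_incidenceSum (insert x (G.closedNeighborFinset v))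
      ((card_insert_le _ _).trans (by omega))
    rw [incidenceSum_insert hx, card_insert_of_notMem hx, hC] at h1
    exact h1
  have hle : ∀ w ∈ G.neighborFinset v,
      G.degree w + #(G.neighborFinset w \ G.closedNeighborFinset v) ≤ b + 3 := by
    intro w hw
    rw [mem_neighborFinset] at hw
    have := hΔ w
    by_cases hwd : 4 ≤ G.degree w
    · have := card_sdiff_closedNeighborFinset_add_degree_le hG.1 hw (by omega) hwd
      omega
    · have := card_sdiff_closedNeighborFinset_lt_degree hw
      omega
  have h1 : G.incidenceSum (G.closedNeighborFinset v) ≤ (b + 2) + (b + 2) * (b + 3) := by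
    have h2 := sum_le_card_nsmul _ _ _ hle
    rw [card_neighborFinset_eq_degree, hv, smul_eq_mul] at h2
    have h3 := card_sdiff_closedNeighborFinset_self (G := G) v
    have h4 : G.incidenceSum (G.closedNeighborFinset v) = (G.degree v +
        #(G.neighborFinset v \ G.closedNeighborFinset v)) + ∑ w ∈ G.neighborFinset v,
          (G.degree w + #(G.neighborFinset w \ G.closedNeighborFinset v)) :=
      sum_insert (by simp)
    omega
  have h2 : ∀ x ∉ G.closedNeighborFinset v,
      4 ≤ #(G.neighborFinset x \ G.closedNeighborFinset v) := by
    intro x hxv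
    have := hx x hxv
    nlinarith
  have h3 : G.incidenceSum (G.closedNeighborFinset v) ≤ #(G.closedNeighborFinset v) • (b + 2) := by
    refine sum_le_card_nsmul _ _ _ fun w hw => ?_
    rcases mem_closedNeighborFinset.1 hw with rfl | hvw
    · rw [card_sdiff_closedNeighborFinset_self]; omega
    · by_cases hwd : 4 ≤ G.degree w
      · have h4 := card_sdiff_closedNeighborFinset_add_degree_le hG.1 hvw (by omega) hwd
        by_cases hwb : b + 1 ≤ G.degree w
        · rcases (G.neighborFinset w \ G.closedNeighborFinset v).eq_empty_or_nonempty with h | h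
          · rw [h, card_empty]; exact hΔ w
          · obtain ⟨x, hxw⟩ := h
            have h5 := card_sdiff_closedNeighborFinset_le hG.1 hw hxw hwb (k := 0) (by omega)
            have h6 := h2 x (mem_sdiff.1 hxw).2
            omega
        · omega
      · have := card_sdiff_closedNeighborFinset_lt_degree hvw
        omega
  rw [hC, smul_eq_mul] at h3
  obtain ⟨x, hxv⟩ : ∃ x, x ∉ G.closedNeighborFinset v := by
    by_contra! h
    have := card_le_card (fun y _ => h y : univ ⊆ G.closedNeighborFinset v)
    rw [card_univ] at this
    omega
  have h4 := hx x hxv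
  have h5 := card_le_card (sdiff_subset (s := G.neighborFinset x)
    (t := G.closedNeighborFinset v))
  rw [card_neighborFinset_eq_degree] at h5
  have h6 := hΔ x
  nlinarith

theorem IsExtremal.degree_le_add_one (hG : G.IsExtremal (doubleStar 3 b).Free) (hb : 3 < b)
    (hconn : G.Connected) (hn : b + 5 ≤ Fintype.card V) (v : V) : G.degree v ≤ b + 1 := by
  have h2 : ∀ w, G.degree w ≤ b + 2 := fun w => by
    have h4 := hG.degree_lt_add_four hb w
    have h3 := hG.degree_ne_add_three hb hconn hn w
    omega
  have h3 := h2 v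
  have h4 := hG.degree_ne_add_two hb h2 hn v
  omega

end MaxDegree

/-! ### Extremal graphs of maximum degree `b + 1` -/

theorem sum_degree_le_add_card_filter {V : Type*} [Fintype V] {G : SimpleGraph V}
    [DecidableRel G.Adj] {b : ℕ} (hΔ : ∀ w, G.degree w ≤ b + 1) :
    ∑ w, G.degree w ≤ b * Fintype.card V + #{u | G.degree u = b + 1} := by
  rw [card_filter, mul_comm, ← card_univ, ← smul_eq_mul, ← sum_const, ← sum_add_distrib]
  refine sum_le_sum fun w _ => ?_
  have := hΔ w
  split_ifs <;> omega

section Clusters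

variable {V : Type*} [Fintype V] [DecidableEq V] {G : SimpleGraph V} [DecidableRel G.Adj] {b : ℕ}
  {v : V}

theorem card_sdiff_closedNeighborFinset_le_two (hfree : (doubleStar 3 b).Free G)
    (hv : G.degree v = b + 1) {w : V} (hw : w ∈ G.closedNeighborFinset v) :
    #(G.neighborFinset w \ G.closedNeighborFinset v) ≤ 2 := by
  rcases mem_closedNeighborFinset.1 hw with rfl | hvw
  · rw [card_sdiff_closedNeighborFinset_self]; omega
  · by_cases hwd : 4 ≤ G.degree w
    · have := card_sdiff_closedNeighborFinset_add_degree_le hfree hvw (by omega) hwd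
      omega
    · have := card_sdiff_closedNeighborFinset_lt_degree hvw
      omega

theorem IsExtremal.add_three_mul_le (hG : G.IsExtremal (doubleStar 3 b).Free)
    (hv : G.degree v = b + 1) {x : V} (hx : x ∉ G.closedNeighborFinset v) :
    (b + 3) * (b + 2) ≤ G.incidenceSum (G.closedNeighborFinset v) +
      2 * #(G.neighborFinset x \ G.closedNeighborFinset v) := by
  have hC := card_closedNeighborFinset (G := G) v
  rw [hv] at hC
  have h1 := hG.le_incidenceSum (insert x (G.closedNeighborFinset v))
    ((card_insert_le _ _).trans (by omega))
  rw [incidenceSum_insert hx, card_insert_of_notMem hx, hC] at h1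
  exact h1

theorem IsExtremal.add_four_mul_le (hG : G.IsExtremal (doubleStar 3 b).Free)
    (hv : G.degree v = b + 1) {x y : V} (hx : x ∉ G.closedNeighborFinset v)
    (hy : y ∉ G.closedNeighborFinset v) (hxy : y ≠ x) :
    (b + 4) * (b + 3) ≤ G.incidenceSum (G.closedNeighborFinset v) +
      2 * #(G.neighborFinset x \ G.closedNeighborFinset v) +
      2 * #(G.neighborFinset y \ G.closedNeighborFinset v) := by
  have hC := card_closedNeighborFinset (G := G) v
  rw [hv] at hC
  have hy' : y ∉ insert x (G.closedNeighborFinset v) := by simp [hxy, hy]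
  have h1 := hG.le_incidenceSum (insert y (insert x (G.closedNeighborFinset v)))
    ((card_insert_le _ _).trans (by rw [card_insert_of_notMem hx]; omega))
  rw [incidenceSum_insert hy', incidenceSum_insert hx, card_insert_of_notMem hy',
    card_insert_of_notMem hx, hC] at h1
  have h2 : #(G.neighborFinset y \ insert x (G.closedNeighborFinset v)) ≤
      #(G.neighborFinset y \ G.closedNeighborFinset v) :=
    card_le_card (sdiff_subset_sdiff subset_rfl (subset_insert _ _))
  have h3 : (b + 1 + 1 + 1 + 1) * (b + 1 + 1 + 1 + 1 - 1) = (b + 4) * (b + 3) := rfl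
  omega

theorem incidenceSum_closedNeighborFinset_le (hv : G.degree v = b + 1) {k : ℕ}
    (hle : ∀ w ∈ G.neighborFinset v,
      G.degree w + #(G.neighborFinset w \ G.closedNeighborFinset v) ≤ b + 1 + k) :
    G.incidenceSum (G.closedNeighborFinset v) ≤ (b + 1) + (b + 1) * (b + 1 + k) := by
  have h2 := sum_le_card_nsmul _ _ _ hle
  rw [card_neighborFinset_eq_degree, hv, smul_eq_mul] at h2
  have h3 := card_sdiff_closedNeighborFinset_self (G := G) v
  have h4 : G.incidenceSum (G.closedNeighborFinset v) = (G.degree v +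
      #(G.neighborFinset v \ G.closedNeighborFinset v)) + ∑ w ∈ G.neighborFinset v,
        (G.degree w + #(G.neighborFinset w \ G.closedNeighborFinset v)) :=
    sum_insert (by simp)
  omega

/-- If `v` has the maximum degree `b + 1`, then a vertex `w` of degree `b + 1` in `N[v]` has no
neighbour `x` outside `N[v]`. Indeed `x` would have at most three neighbours outside `N[v]`. As
`N[v] ∪ {x, y}` meets as many edges as a clique, all neighbours of any other `y` would be outside
`N[v]`, so `x` would carry all edges leaving `N[v]`; these are too few for `N[v] ∪ {x}`. -/
theorem IsExtremal.sdiff_closedNeighborFinset_eq_empty (hG : G.IsExtremal (doubleStar 3 b).Free)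
    (hb : 3 < b) (hΔ : ∀ w, G.degree w ≤ b + 1) (hv : G.degree v = b + 1) {w : V}
    (hw : w ∈ G.closedNeighborFinset v) (hwd : G.degree w = b + 1) :
    G.neighborFinset w \ G.closedNeighborFinset v = ∅ := by
  by_contra hne
  obtain ⟨x, hxw⟩ := nonempty_iff_ne_empty.2 hne
  have hxv := (mem_sdiff.1 hxw).2
  have hout (u) (hu : u ∈ G.closedNeighborFinset v) :=
    card_sdiff_closedNeighborFinset_le_two hG.1 hv hu
  have hx3 := card_sdiff_closedNeighborFinset_le hG.1 hw hxw hwd.ge (k := 1) (hout w hw)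
  have h1 := incidenceSum_closedNeighborFinset_le hv (k := 2) fun u hu =>
    Nat.add_le_add (hΔ u) (hout u (mem_insert_of_mem hu))
  have hy : ∀ y ∉ G.closedNeighborFinset v, y ≠ x →
      G.neighborFinset y \ G.closedNeighborFinset v = G.neighborFinset y := by
    intro y hyv hyx
    refine eq_of_subset_of_card_le sdiff_subset ?_
    rw [card_neighborFinset_eq_degree]
    have h2 := hG.add_four_mul_le hv hxv hyv hyx
    have h3 := hΔ y
    nlinarith
  have hout' : ∀ u ∈ G.closedNeighborFinset v,
      #(G.neighborFinset u \ G.closedNeighborFinset v) ≤ 1 := by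
    intro u hu
    rw [← card_singleton x]
    refine card_le_card fun y hyu => ?_
    obtain ⟨h2, h3⟩ := mem_sdiff.1 hyu
    rw [mem_singleton]
    by_contra hyx
    have h4 : u ∈ G.neighborFinset y := by simpa [adj_comm] using h2
    rw [← hy y h3 hyx] at h4
    exact (mem_sdiff.1 h4).2 hu
  have h2 := incidenceSum_closedNeighborFinset_le hv (k := 1) fun u hu =>
    Nat.add_le_add (hΔ u) (hout' u (mem_insert_of_mem hu))
  have h3 := hG.add_three_mul_le hv hxv
  nlinarith

/-- A vertex of degree at most `b` in `N[v]` contributes at most `b + 2` to the edges meeting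
`N[v]`, a vertex of degree `b + 1` only `b + 1`. -/
theorem IsExtremal.degree_add_card_sdiff_le (hG : G.IsExtremal (doubleStar 3 b).Free)
    (hb : 3 < b) (hΔ : ∀ w, G.degree w ≤ b + 1) (hv : G.degree v = b + 1) {w : V}
    (hw : w ∈ G.closedNeighborFinset v) :
    G.degree w + #(G.neighborFinset w \ G.closedNeighborFinset v) +
      (if G.degree w = b + 1 then 1 else 0) ≤ b + 2 := by
  split_ifs with h
  · rw [hG.sdiff_closedNeighborFinset_eq_empty hb hΔ hv hw h, card_empty, h]
  · have h1 := card_sdiff_closedNeighborFinset_le_two hG.1 hv hw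
    have h2 := hΔ w
    omega

theorem IsExtremal.incidenceSum_add_card_le (hG : G.IsExtremal (doubleStar 3 b).Free)
    (hb : 3 < b) (hΔ : ∀ w, G.degree w ≤ b + 1) (hv : G.degree v = b + 1) :
    G.incidenceSum (G.closedNeighborFinset v) +
      #{u ∈ G.closedNeighborFinset v | G.degree u = b + 1} ≤ (b + 2) * (b + 2) := by
  have h := sum_le_card_nsmul _ _ _ fun w (hw : w ∈ G.closedNeighborFinset v) =>
    hG.degree_add_card_sdiff_le hb hΔ hv hw
  rw [sum_add_distrib, ← card_filter, card_closedNeighborFinset, hv, smul_eq_mul] at h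
  exact h

theorem card_filter_degree_pos (hv : G.degree v = b + 1) :
    0 < #{u ∈ G.closedNeighborFinset v | G.degree u = b + 1} :=
  card_pos.2 ⟨v, mem_filter.2 ⟨mem_insert_self _ _, hv⟩⟩

/-- Vertices of degree `b + 1` are adjacent only if they have the same closed neighbourhood. -/
theorem IsExtremal.closedNeighborFinset_eq (hG : G.IsExtremal (doubleStar 3 b).Free)
    (hb : 3 < b) (hΔ : ∀ w, G.degree w ≤ b + 1) (hv : G.degree v = b + 1) {u : V}
    (hu : u ∈ G.closedNeighborFinset v) (hud : G.degree u = b + 1) :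
    G.closedNeighborFinset u = G.closedNeighborFinset v := by
  refine eq_of_subset_of_card_le (insert_subset hu ?_) ?_
  · exact sdiff_eq_empty_iff_subset.1 (hG.sdiff_closedNeighborFinset_eq_empty hb hΔ hv hu hud)
  · rw [card_closedNeighborFinset, card_closedNeighborFinset, hv, hud]

/-- If distinct closed neighbourhoods of vertices `v`, `x` of degree `b + 1` meet, then `N[v]` has
at most two vertices of degree `b + 1`: they are all adjacent to a common vertex of `N[v]` and
`N[x]`, which has at most two neighbours outside `N[x]`. -/
theorem IsExtremal.card_filter_degree_le_two (hG : G.IsExtremal (doubleStar 3 b).Free)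
    (hb : 3 < b) (hΔ : ∀ w, G.degree w ≤ b + 1) (hv : G.degree v = b + 1) {x w : V}
    (hx : G.degree x = b + 1) (hxv : x ∉ G.closedNeighborFinset v)
    (hwv : w ∈ G.closedNeighborFinset v) (hwx : w ∈ G.closedNeighborFinset x) :
    #{u ∈ G.closedNeighborFinset v | G.degree u = b + 1} ≤ 2 := by
  refine (card_le_card fun u hu => ?_).trans
    (card_sdiff_closedNeighborFinset_le_two hG.1 hx hwx)
  obtain ⟨huv, hud⟩ := mem_filter.1 hu
  have h1 := hG.closedNeighborFinset_eq hb hΔ hv huv hud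
  have hself : x ∈ G.closedNeighborFinset x := mem_insert_self _ _
  rw [mem_sdiff, mem_neighborFinset]
  constructor
  · rw [← h1] at hwv
    rcases mem_closedNeighborFinset.1 hwv with rfl | h
    · rw [← hG.closedNeighborFinset_eq hb hΔ hx hwx hud, h1] at hself
      exact absurd hself hxv
    · exact h.symm
  · intro hux
    rw [← hG.closedNeighborFinset_eq hb hΔ hx hux hud, h1] at hself
    exact hxv hself

/-- Each of the `r` vertices outside `N[v]` has at most `r - 1` neighbours outside `N[v]`. -/
theorem sum_degree_add_le_incidenceSum_add (hv : G.degree v = b + 1) {r : ℕ}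
    (hr : Fintype.card V = b + 2 + r) :
    ∑ w, G.degree w + r ≤ G.incidenceSum (G.closedNeighborFinset v) + r * r := by
  have h1 := sum_degree_eq_incidenceSum_add (G := G) (G.closedNeighborFinset v)
  have h2 : #(G.closedNeighborFinset v)ᶜ = r := by
    rw [card_compl, card_closedNeighborFinset, hv, hr]
    omega
  have h3 : ∑ x ∈ (G.closedNeighborFinset v)ᶜ,
      (#(G.neighborFinset x \ G.closedNeighborFinset v) + 1) ≤
        #(G.closedNeighborFinset v)ᶜ • r := by
    refine sum_le_card_nsmul _ _ _ fun x hx => ?_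
    rw [← h2, Nat.succ_le_iff]
    refine card_lt_card (Finset.ssubset_iff_subset_ne.2 ⟨fun y hy => ?_, fun h => ?_⟩)
    · exact mem_compl.2 (mem_sdiff.1 hy).2
    · rw [← h] at hx
      simp at hx
  rw [sum_add_distrib, sum_const, h2, smul_eq_mul, smul_eq_mul, mul_one] at h3
  omega

/-- If there is a vertex of degree `b + 1` outside `N[v]` and at most `2 * b + 3` vertices in all,
then its closed neighbourhood meets that of `v`, in `o` vertices say, and there are few vertices of
degree `b + 1`. Moreover `o` is less than `b / 2`, and `N[v]` meets fewer edges than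
`IsExtremal.incidenceSum_add_card_le` allows, because the common vertices have degree at most
`o + 3`. -/
theorem IsExtremal.exists_card_inter (hG : G.IsExtremal (doubleStar 3 b).Free)
    (hb : 3 < b) (hΔ : ∀ w, G.degree w ≤ b + 1) (hv : G.degree v = b + 1) {x : V}
    (hx : G.degree x = b + 1) (hxv : x ∉ G.closedNeighborFinset v)
    (hn : Fintype.card V ≤ 2 * b + 3) :
    ∃ o, 2 * o + 1 ≤ b ∧ #{u | G.degree u = b + 1} + 2 * b ≤ Fintype.card V + o ∧
      G.incidenceSum (G.closedNeighborFinset v) +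
        #{u ∈ G.closedNeighborFinset v | G.degree u = b + 1} + b ≤ (b + 2) * (b + 2) + o + 3 := by
  set C := G.closedNeighborFinset v with hC
  set D := G.closedNeighborFinset x with hD
  have hcC : #C = b + 2 := by rw [hC, card_closedNeighborFinset, hv]
  have hcD : #D = b + 2 := by rw [hD, card_closedNeighborFinset, hx]
  have hunion := card_union_add_card_inter C D
  have hle := card_le_univ (C ∪ D)
  have hvx : v ∉ D := fun h => by
    rw [hC, hG.closedNeighborFinset_eq hb hΔ hx h hv] at hxv
    exact hxv (mem_insert_self _ _)
  obtain ⟨w, hw⟩ : (C ∩ D).Nonempty := card_pos.1 (by omega)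
  obtain ⟨hwC, hwD⟩ := mem_inter.1 hw
  refine ⟨#(C ∩ D), ?_, ?_, ?_⟩
  · have h1 := hG.add_three_mul_le hv hxv
    have h2 := hG.incidenceSum_add_card_le hb hΔ hv
    have h3 := card_filter_degree_pos hv
    have h4 : #(G.neighborFinset x \ C) + 1 ≤ #(D \ C) := by
      have : D \ C = insert x (G.neighborFinset x \ C) := by
        rw [hD, closedNeighborFinset, insert_sdiff_of_notMem _ hxv]
      rw [this, card_insert_of_notMem (by simp)]
    have h5 := card_sdiff_add_card_inter D C
    rw [inter_comm] at h5
    rw [← hC] at h1 h2 h3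
    nlinarith
  · have h1 : ({u | G.degree u = b + 1} : Finset V) ⊆
        ({u ∈ C | G.degree u = b + 1} ∪ {u ∈ D | G.degree u = b + 1}) ∪ (C ∪ D)ᶜ := by
      intro u hu
      simp only [mem_union, mem_filter, mem_compl, mem_univ, true_and] at hu ⊢
      tauto
    have h2 := (card_le_card h1).trans
      ((card_union_le _ _).trans (Nat.add_le_add_right (card_union_le _ _) _))
    have h3 := hG.card_filter_degree_le_two hb hΔ hv hx hxv hwC hwD
    have h4 := hG.card_filter_degree_le_two hb hΔ hx hv hvx hwD hwC
    rw [card_compl] at h2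
    rw [← hC] at h3
    rw [← hD] at h4
    omega
  · have hwout := card_sdiff_closedNeighborFinset_le_two hG.1 hv hwC
    have hwout' := card_sdiff_closedNeighborFinset_le_two hG.1 hx hwD
    rw [← hC] at hwout
    rw [← hD] at hwout'
    have h1 : G.neighborFinset w ⊆
        (G.neighborFinset w \ C ∪ G.neighborFinset w \ D) ∪ (C ∩ D).erase w := by
      intro y hy
      have : y ≠ w := fun h => by simp [h] at hy
      simp only [mem_union, mem_sdiff, mem_erase, mem_inter]
      tauto
    have h2 := (card_le_card h1).trans
      ((card_union_le _ _).trans (Nat.add_le_add_right (card_union_le _ _) _))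
    rw [card_neighborFinset_eq_degree, card_erase_of_mem hw] at h2
    have hpos := card_pos.2 ⟨w, hw⟩
    have hwd : G.degree w ≠ b + 1 := by
      intro h
      rw [hC, ← hG.closedNeighborFinset_eq hb hΔ hv hwC h,
        hG.closedNeighborFinset_eq hb hΔ hx hwD h] at hxv
      exact hxv (mem_insert_self _ _)
    have h3 := sum_le_card_nsmul _ _ _ fun u (hu : u ∈ C.erase w) =>
      hG.degree_add_card_sdiff_le hb hΔ hv (mem_of_mem_erase hu)
    have h4 := add_sum_erase C (fun u => G.degree u + #(G.neighborFinset u \ C) +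
      (if G.degree u = b + 1 then 1 else 0)) hwC
    have h5 : ∑ u ∈ C, (G.degree u + #(G.neighborFinset u \ C) +
        (if G.degree u = b + 1 then 1 else 0)) =
          G.incidenceSum C + #{u ∈ C | G.degree u = b + 1} := by
      rw [sum_add_distrib, ← card_filter, incidenceSum]
    rw [card_erase_of_mem hwC, hcC, smul_eq_mul, ← hC] at h3
    simp only [hwd, if_false] at h4
    rw [show b + 2 - 1 = b + 1 by omega] at h3
    have h6 : (b + 2) * (b + 2) = (b + 1) * (b + 2) + (b + 2) := by ring
    omega

end Clusters

/-! ### The number of edges -/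

section EdgeCount

variable {V : Type*} [Fintype V] [DecidableEq V] {G : SimpleGraph V} [DecidableRel G.Adj] {b : ℕ}
  {v : V}

/-- With at most `2 * b` vertices, or with at most `2 * b + 2` vertices for small `b`, a graph with
a vertex of degree `b + 1` has fewer edges than a nearly `b`-regular graph or a union of two
cliques, respectively. -/
theorem IsExtremal.eleven_le_and_lt_card (hG : G.IsExtremal (doubleStar 3 b).Free) (hb : 3 < b)
    (hΔ : ∀ w, G.degree w ≤ b + 1) (hn : b + 5 ≤ Fintype.card V)
    (hn' : Fintype.card V ≤ 2 * b + 2) (hv : G.degree v = b + 1) :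
    11 ≤ b ∧ 2 * b < Fintype.card V := by
  obtain ⟨m, hm⟩ : ∃ m, Fintype.card V = m + 1 + (b + 4) := ⟨Fintype.card V - (b + 5), by omega⟩
  have h1 := sum_degree_add_le_incidenceSum_add hv (r := m + 3) (by omega)
  have h2 := hG.incidenceSum_add_card_le hb hΔ hv
  have h3 := card_filter_degree_pos hv
  have h4 := card_edgeFinset_of_isExtremal_free hG
  have h5 := G.sum_degrees_eq_twice_card_edges
  have h6 := two_mul_extremalNumber_add_le 3 b (m + 1) (b + 4) (by omega)
  have h7 := mul_pred_le_two_mul_extremalNumber 3 b (m + 1) (by omega)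
  have h8 := mul_le_two_mul_extremalNumber_add_one 3 b (Fintype.card V) (by omega)
  rw [← hm, ← h4, ← h5, show b + 4 - 1 = b + 3 by omega] at h6
  rw [show m + 1 - 1 = m by omega] at h7
  rw [← h4, ← h5, hm] at h8
  have hb11 : 11 ≤ b := by
    by_contra! h
    nlinarith
  refine ⟨hb11, ?_⟩
  by_contra! h
  obtain ⟨k, rfl⟩ : ∃ k, b = m + 5 + k := ⟨b - (m + 5), by omega⟩
  nlinarith [Nat.zero_le (m * k)]

theorem filter_degree_eq_of_forall (h : ∀ x, G.degree x = b + 1 → x ∈ G.closedNeighborFinset v) :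
    ({u ∈ G.closedNeighborFinset v | G.degree u = b + 1} : Finset V) =
      ({u | G.degree u = b + 1} : Finset V) := by
  ext u
  simp only [mem_filter, mem_univ, true_and, and_iff_right_iff_imp]
  exact h u

theorem IsExtremal.sum_degree_le_of_card_eq_two_mul_add_one
    (hG : G.IsExtremal (doubleStar 3 b).Free) (hb : 11 ≤ b) (hΔ : ∀ w, G.degree w ≤ b + 1)
    (hn : Fintype.card V = 2 * b + 1) (hv : G.degree v = b + 1) :
    ∑ w, G.degree w ≤ b * (2 * b + 1) + 3 := by
  obtain ⟨c, rfl⟩ : ∃ c, b = c + 1 := ⟨b - 1, by omega⟩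
  have h1 := sum_degree_add_le_incidenceSum_add hv (r := c) (by omega)
  have h2 := hG.incidenceSum_add_card_le (by omega) hΔ hv
  have h3 := card_filter_degree_pos hv
  by_cases h : ∀ x, G.degree x = c + 1 + 1 → x ∈ G.closedNeighborFinset v
  · have h4 := sum_degree_le_add_card_filter hΔ
    rw [← filter_degree_eq_of_forall h, hn] at h4
    -- The bounds `bn + h` and `bn + 6 - h`, for `h` vertices of degree `b + 1`.
    have h5 : (c + 1 + 2) * (c + 1 + 2) + c * c = (c + 1) * (2 * (c + 1) + 1) + c + 6 := by ring
    omega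
  · push Not at h
    obtain ⟨x, hx, hxv⟩ := h
    obtain ⟨o, ho1, -, ho2⟩ := hG.exists_card_inter (by omega) hΔ hv hx hxv (by omega)
    have h5 : (c + 1 + 2) * (c + 1 + 2) + c * c = (c + 1) * (2 * (c + 1) + 1) + c + 6 := by ring
    omega

theorem IsExtremal.sum_degree_le_of_card_eq_two_mul_add_two
    (hG : G.IsExtremal (doubleStar 3 b).Free) (hb : 3 < b) (hΔ : ∀ w, G.degree w ≤ b + 1)
    (hn : Fintype.card V = 2 * b + 2) (hv : G.degree v = b + 1) :
    ∑ w, G.degree w ≤ b * (2 * b + 2) + (2 + b / 2) := by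
  have h1 := sum_degree_add_le_incidenceSum_add hv (r := b) (by omega)
  have h2 := hG.incidenceSum_add_card_le hb hΔ hv
  have h4 := sum_degree_le_add_card_filter hΔ
  rw [hn] at h4
  by_cases h : ∀ x, G.degree x = b + 1 → x ∈ G.closedNeighborFinset v
  · rw [← filter_degree_eq_of_forall h] at h4
    -- The bounds `bn + h` and `bn + b + 4 - h`, for `h` vertices of degree `b + 1`.
    have h5 : (b + 2) * (b + 2) + b * b = b * (2 * b + 2) + 2 * b + 4 := by ring
    omega
  · push Not at h
    obtain ⟨x, hx, hxv⟩ := h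
    obtain ⟨o, ho1, ho2, -⟩ := hG.exists_card_inter hb hΔ hv hx hxv (by omega)
    omega

theorem IsExtremal.card_ne_two_mul_add_three (hG : G.IsExtremal (doubleStar 3 b).Free)
    (hb : 3 < b) (hΔ : ∀ w, G.degree w ≤ b + 1) (hv : G.degree v = b + 1) :
    Fintype.card V ≠ 2 * b + 3 := by
  intro hn
  obtain ⟨c, rfl⟩ : ∃ c, b = c + 1 := ⟨b - 1, by omega⟩
  have h1 := sum_degree_le_add_card_filter hΔ
  have h2 := card_edgeFinset_of_isExtremal_free hG
  have h3 := G.sum_degrees_eq_twice_card_edges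
  have h4 := two_mul_extremalNumber_add_le 3 (c + 1) c (c + 5) (by omega)
  have h5 := mul_pred_le_two_mul_extremalNumber 3 (c + 1) c (by omega)
  have h6 : #{u | G.degree u = c + 1 + 1} ≤ c + 3 := by
    by_cases h : ∀ x, G.degree x = c + 1 + 1 → x ∈ G.closedNeighborFinset v
    · rw [← filter_degree_eq_of_forall h]
      refine (card_le_card (filter_subset _ _)).trans ?_
      rw [card_closedNeighborFinset, hv]
    · push Not at h
      obtain ⟨x, hx, hxv⟩ := h
      obtain ⟨o, ho1, ho2, -⟩ := hG.exists_card_inter hb hΔ hv hx hxv (by omega)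
      omega
  rw [hn] at h1
  rw [show c + (c + 5) = 2 * (c + 1) + 3 by ring, ← hn, ← h2, ← h3,
    show c + 5 - 1 = c + 4 by omega] at h4
  obtain ⟨e, rfl⟩ : ∃ e, c = e + 1 := ⟨c - 1, by omega⟩
  rw [show e + 1 - 1 = e by omega] at h5
  nlinarith

end EdgeCount

end SimpleGraph

open SimpleGraph in
theorem lemma1p5 {V : Type*} [Fintype V] (n b : ℕ) (hb : 3 < b) (hn : b + 5 ≤ n)
    (G : SimpleGraph V) [DecidableRel G.Adj]
    (hG : MemEx n (doubleStar 3 b) G) (hconn : G.Connected) :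
    n < 2 * (b + 4) ∧
    ((b ≤ 10 ∨ (11 ≤ b ∧ n ≠ 2 * b + 1 ∧ n ≠ 2 * b + 2)) →
      G.maxDegree = b ∧ G.edgeFinset.card = b * n / 2) ∧
    (11 ≤ b → n = 2 * b + 1 →
      G.maxDegree = b + 1 ∧ G.edgeFinset.card = (b * n + 3) / 2) ∧
    (11 ≤ b → n = 2 * b + 2 →
      G.maxDegree = b + 1 ∧ G.edgeFinset.card = (b * n + 2 + b / 2) / 2) := by
  classical
  obtain ⟨rfl, hfree, hcard⟩ := hG
  have hE : G.IsExtremal (doubleStar 3 b).Free := isExtremal_free_iff.2 ⟨hfree, hcard⟩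
  have hΔ := hE.degree_le_add_one hb hconn hn
  have hsum := G.sum_degrees_eq_twice_card_edges
  have hne : Nonempty V := hconn.nonempty
  have hmax : G.maxDegree ≤ b + 1 := G.maxDegree_le_of_forall_degree_le _ hΔ
  have hle (k : ℕ) (h : G.maxDegree ≤ k) : 2 * #G.edgeFinset ≤ k * Fintype.card V := by
    rw [← hsum, mul_comm, ← card_univ, ← smul_eq_mul]
    exact sum_le_card_nsmul _ _ _ fun w _ => (G.degree_le_maxDegree w).trans h
  have hlow := mul_le_two_mul_extremalNumber_add_one 3 b (Fintype.card V) (by omega)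
  rw [← hcard] at hlow
  have hn4 : Fintype.card V < 2 * b + 4 := by
    by_contra! h
    have h1 := mul_lt_two_mul_extremalNumber b _ h
    have h2 := hle _ hmax
    omega
  have hhigh (h : b < G.maxDegree) : ∃ v, G.degree v = b + 1 := by
    obtain ⟨v, hv⟩ := G.exists_maximal_degree_vertex
    exact ⟨v, by omega⟩
  refine ⟨by omega, fun hcase => ?_, fun hb11 hn1 => ?_, fun hb11 hn2 => ?_⟩
  · have h1 : G.maxDegree ≤ b := by
      by_contra! h
      obtain ⟨v, hv⟩ := hhigh h
      have h2 := hE.card_ne_two_mul_add_three hb hΔ hv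
      have h3 := hE.eleven_le_and_lt_card hb hΔ hn (by omega) hv
      omega
    have h2 := hle b h1
    refine ⟨le_antisymm h1 ?_, by omega⟩
    by_contra! h
    have h3 := hle (b - 1) (by omega)
    obtain ⟨c, rfl⟩ : ∃ c, b = c + 1 := ⟨b - 1, by omega⟩
    rw [Nat.add_sub_cancel] at h3
    rw [add_mul, one_mul] at hlow
    omega
  · have h1 := mul_add_three_le_two_mul_extremalNumber b (by omega)
    rw [← hn1, ← hcard] at h1
    have h2 : b < G.maxDegree := by
      by_contra! h
      have := hle b h
      omega
    obtain ⟨v, hv⟩ := hhigh h2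
    have h3 := hE.sum_degree_le_of_card_eq_two_mul_add_one hb11 hΔ hn1 hv
    rw [← hn1] at h3
    exact ⟨by omega, by omega⟩
  · have h1 := mul_add_half_le_two_mul_extremalNumber b (by omega)
    rw [← hn2, ← hcard] at h1
    have h2 : b < G.maxDegree := by
      by_contra! h
      have := hle b h
      omega
    obtain ⟨v, hv⟩ := hhigh h2
    have h3 := hE.sum_degree_le_of_card_eq_two_mul_add_two hb hΔ hn2 hv
    rw [← hn2] at h3
    exact ⟨by omega, by omega⟩
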